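/- Let $\Bbbk$ be an algebraically closed field of characteristic zero, let $\mathbb{Z}_2=\{1,g\}$ be the (multiplicatively written) cyclic group of order $2$, write $G=\mathbb{Z}_2$, and let $F$ be an arbitrary group. Let $(F,G,\triangleleft,\triangleright)$ be a matched pair of groups, i.e. $\triangleright: G\times F\to F$ is a left action of the group $G$ on the set $F$ and $\triangleleft: G\times F\to G$ is a right action of the group $F$ on the set $G$ such that $$x\triangleright(ff')=(x\triangleright f)\bigl((x\triangleleft f)\triangleright f'\bigr),\qquad (xx')\triangleleft f=\bigl(x\triangleleft(x'\triangleright f)\bigr)(x'\triangleleft f)\qquad(x,x'\in G,\ f,f'\in F).$$ Let $\sigma:G\times F\times F\to\Bbbk^\times$, $(x,f,f')\mapsto\sigma(x;f,f')$, and $\tau:G\times G\times F\to\Bbbk^\times$, $(x,x',f)\mapsto\tau(x,x';f)$, satisfy, for all $x,x',x''\in G$ and $f,f',f''\in F$, $$\sigma(x;1,f)=\sigma(x;f,1)=\sigma(1;f,f')=1,\qquad \tau(1,x;f)=\tau(x,1;f)=\tau(x,x';1)=1,$$ $$\sigma(x\triangleleft f;f',f'')\,\sigma(x;f,f'f'')=\sigma(x;f,f')\,\sigma(x;ff',f''),$$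 $$\tau(x,x';x''\triangleright f)\,\tau(xx',x'';f)=\tau(x,x'x'';f)\,\tau(x',x'';f),$$ $$\sigma(xx';f,f')\,\tau(x,x';ff')=\sigma\bigl(x;x'\triangleright f,(x'\triangleleft f)\triangleright f'\bigr)\,\sigma(x';f,f')\,\tau(x,x';f)\,\tau\bigl(x\triangleleft(x'\triangleright f),x'\triangleleft f;f'\bigr).$$ Let $H=\Bbbk^{\mathbb{Z}_2}{}^\tau\#_\sigma\Bbbk F$ be the corresponding Hopf algebra: the vector space $\Bbbk^{G}\otimes\Bbbk F$ with basis $p_x\# f$ ($x\in G$, $f\in F$), with unit $\sum_{x}p_x\#1$, counit $\varepsilon(p_x\# f)=\delta_{x,1}$, and $$(p_x\# f)(p_{x'}\# f')=\delta_{x\triangleleft f,\,x'}\,\sigma(x;f,f')\,p_x\# ff',$$ $$\Delta(p_x\# f)=\sum_{y\in G}\tau(xy^{-1},y;f)\,\bigl(p_{xy^{-1}}\#(y\triangleright f)\bigr)\otimes(p_y\# f),$$ $$\mathcal{S}(p_x\# f)=\sigma\bigl(x^{-1};x\triangleright f,(x\triangleright f)^{-1}\bigr)^{-1}\tau(x^{-1},x;f)^{-1}\,p_{(x\triangleleft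 f)^{-1}}\#(x\triangleright f)^{-1},$$ where $\mathcal{S}$ is the antipode. Let $\operatorname{Gr}(H\text{-comod})$ be the Grothendieck ring of the category of finite-dimensional right $H$-comodules: the quotient of the free abelian group on the isomorphism classes of such comodules by the subgroup generated by all $[Y]-[X]-[Z]$ with $0\to X\to Y\to Z\to0$ a short exact sequence, with product induced by $[M][N]=[M\otimes N]$. If the ring $\operatorname{Gr}(H\text{-comod})$ is commutative, then $S=\{f\in F\mid g\triangleright f=f\}$ is an abelian group, i.e. $S$ is a subgroup of $F$ and $ff'=f'f$ for all $f,f'\in S$. -/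

import Mathlib

open scoped TensorProduct

universe u v w

/-- A matched pair of groups `(F, G, ◁, ▷)`: a left action `▷ : G × F → F` of the group `G` on the
set `F` and a right action `◁ : G × F → G` of the group `F` on the set `G`, with
`g ▷ (f f') = (g ▷ f) ((g ◁ f) ▷ f')` and `(g g') ◁ f = (g ◁ (g' ▷ f)) (g' ◁ f)`.
Here `lact g f` is `g ▷ f` and `ract g f` is `g ◁ f`. -/
structure MatchedPair (G : Type v) (F : Type w) [Group G] [Group F] where
  lact : G → F → F
  ract : G → F → G
  one_lact : ∀ f, lact 1 f = f
  mul_lact : ∀ g g' f, lact (g * g') f = lact g (lact g' f)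
  ract_one : ∀ g, ract g 1 = g
  ract_mul : ∀ g f f', ract g (f * f') = ract (ract g f) f'
  lact_mul : ∀ g f f', lact g (f * f') = lact g f * lact (ract g f) f'
  mul_ract : ∀ g g' f, ract (g * g') f = ract g (lact g' f) * ract g' f

namespace MatchedPair

variable {G : Type v} {F : Type w} [Group G] [Group F] (M : MatchedPair G F)

theorem lact_one (g : G) : M.lact g 1 = 1 := by
  have h := M.lact_mul g 1 1
  rw [M.ract_one, mul_one] at h
  exact (mul_eq_left.mp h.symm)

theorem one_ract (f : F) : M.ract 1 f = 1 := by
  have h := M.mul_ract 1 1 f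
  rw [M.one_lact, mul_one] at h
  exact (mul_eq_left.mp h.symm)

theorem lact_inv (g : G) (f : F) : (M.lact g f)⁻¹ = M.lact (M.ract g f) f⁻¹ := by
  rw [inv_eq_iff_mul_eq_one, ← M.lact_mul, mul_inv_cancel, M.lact_one]

theorem ract_inv (g : G) (f : F) : (M.ract g f)⁻¹ = M.ract g⁻¹ (M.lact g f) := by
  rw [eq_comm, eq_inv_iff_mul_eq_one, ← M.mul_ract, inv_mul_cancel, M.one_ract]

theorem ract_ract_inv (g : G) (f : F) : M.ract (M.ract g f) f⁻¹ = g := by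
  rw [← M.ract_mul, mul_inv_cancel, M.ract_one]

theorem ract_inv_ract (g : G) (f : F) : M.ract (M.ract g f⁻¹) f = g := by
  rw [← M.ract_mul, inv_mul_cancel, M.ract_one]

end MatchedPair

/-- The pair of normalized cocycles `σ : G × F × F → kˣ`, `τ : G × G × F → kˣ` over a matched pair
of groups, together with their compatibility. Here `σ g f f'` is `σ(g; f, f')` and `τ g g' f` is
`τ(g, g'; f)`. -/
structure CocyclePair (k : Type u) [Field k] {G : Type v} {F : Type w} [Group G] [Group F]
    (M : MatchedPair G F) where
  σ : G → F → F → kˣ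
  τ : G → G → F → kˣ
  σ_one_left : ∀ g f, σ g 1 f = 1
  σ_one_right : ∀ g f, σ g f 1 = 1
  σ_one : ∀ f f', σ 1 f f' = 1
  σ_cocycle : ∀ g f f' f'',
    σ (M.ract g f) f' f'' * σ g f (f' * f'') = σ g f f' * σ g (f * f') f''
  τ_one_left : ∀ g f, τ 1 g f = 1
  τ_one_right : ∀ g f, τ g 1 f = 1
  τ_one : ∀ g g', τ g g' 1 = 1
  τ_cocycle : ∀ g g' g'' f,
    τ g g' (M.lact g'' f) * τ (g * g') g'' f = τ g (g' * g'') f * τ g' g'' f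
  compat : ∀ g g' f f',
    σ (g * g') f f' * τ g g' (f * f') =
      σ g (M.lact g' f) (M.lact (M.ract g' f) f') * σ g' f f' *
        τ g g' f * τ (M.ract g (M.lact g' f)) (M.ract g' f) f'

/-- The underlying space of the Hopf algebra `k^G {}^τ#_σ kF`: the `k`-vector space with basis
`p_g # f`, `(g, f) ∈ G × F` (that is, `k^G ⊗ kF` for finite `G`). -/
def AbelianExt {k : Type u} [Field k] {G : Type v} {F : Type w} [Group G] [Group F]
    {M : MatchedPair G F} (_D : CocyclePair k M) : Type (max u v w) :=
  (G × F) →₀ k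

namespace AbelianExt

variable {k : Type u} [Field k] {G : Type v} {F : Type w} [Group G] [Group F]
variable {M : MatchedPair G F} (D : CocyclePair k M)

noncomputable instance : AddCommGroup (AbelianExt D) :=
  inferInstanceAs (AddCommGroup ((G × F) →₀ k))

noncomputable instance : Module k (AbelianExt D) :=
  inferInstanceAs (Module k ((G × F) →₀ k))

/-- The basis of `k^G {}^τ#_σ kF` whose member at `(g, f)` is `p_g # f`. -/
noncomputable def basis : Module.Basis (G × F) k (AbelianExt D) :=
  Module.Basis.ofRepr (LinearEquiv.refl k ((G × F) →₀ k))


theorem induction_basis {P : AbelianExt D → Prop} (hb : ∀ p, P (basis D p)) (h0 : P 0)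
    (ha : ∀ x y, P x → P y → P (x + y)) (hs : ∀ (c : k) x, P x → P (c • x))
    (x : AbelianExt D) : P x := by
  refine Submodule.span_induction (p := fun x _ => P x) ?_ h0 (fun x y _ _ => ha x y)
    (fun c x _ => hs c x) ((basis D).mem_span x)
  rintro _ ⟨p, rfl⟩
  exact hb p

/-- The antipode: `S(p_g # f) = σ(g⁻¹; g ▷ f, (g ▷ f)⁻¹)⁻¹ τ(g⁻¹, g; f)⁻¹
p_{(g ◁ f)⁻¹} # (g ▷ f)⁻¹`. -/
noncomputable def antipodeMap : AbelianExt D →ₗ[k] AbelianExt D :=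
  (basis D).constr k fun p =>
    (((D.σ p.1⁻¹ (M.lact p.1 p.2) (M.lact p.1 p.2)⁻¹)⁻¹ * (D.τ p.1⁻¹ p.1 p.2)⁻¹ : kˣ) : k) •
      basis D ((M.ract p.1 p.2)⁻¹, (M.lact p.1 p.2)⁻¹)

theorem antipodeMap_basis (p : G × F) : antipodeMap D (basis D p) =
    (((D.σ p.1⁻¹ (M.lact p.1 p.2) (M.lact p.1 p.2)⁻¹)⁻¹ * (D.τ p.1⁻¹ p.1 p.2)⁻¹ : kˣ) : k) •
      basis D ((M.ract p.1 p.2)⁻¹, (M.lact p.1 p.2)⁻¹) := by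
  simp [antipodeMap]

section Fintype

variable [Fintype G]

/-- The unit `1 # 1 = ∑_g p_g # 1`. -/
noncomputable def unit : AbelianExt D := ∑ g : G, basis D (g, 1)

/-- The comultiplication:
`Δ(p_g # f) = ∑_x τ(g x⁻¹, x; f) (p_{g x⁻¹} # (x ▷ f)) ⊗ (p_x # f)`. -/
noncomputable def comulMap : AbelianExt D →ₗ[k] AbelianExt D ⊗[k] AbelianExt D :=
  (basis D).constr k fun p => ∑ x : G, (D.τ (p.1 * x⁻¹) x p.2 : k) •
    (basis D (p.1 * x⁻¹, M.lact x p.2) ⊗ₜ[k] basis D (x, p.2))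

theorem comulMap_basis (p : G × F) : comulMap D (basis D p) =
    ∑ x : G, (D.τ (p.1 * x⁻¹) x p.2 : k) •
      (basis D (p.1 * x⁻¹, M.lact x p.2) ⊗ₜ[k] basis D (x, p.2)) := by
  simp [comulMap]

end Fintype

section DecidableEq

variable [DecidableEq G]

/-- The multiplication: `(p_g # f)(p_g' # f') = δ_{g ◁ f, g'} σ(g; f, f') p_g # f f'`. -/
noncomputable def mulMap : AbelianExt D →ₗ[k] AbelianExt D →ₗ[k] AbelianExt D :=
  (basis D).constr k fun p => (basis D).constr k fun q =>
    if M.ract p.1 p.2 = q.1 then (D.σ p.1 p.2 q.2 : k) • basis D (p.1, p.2 * q.2) else 0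

/-- The counit: `ε(p_g # f) = δ_{g, 1}`. -/
noncomputable def counitMap : AbelianExt D →ₗ[k] k :=
  (basis D).constr k fun p => if p.1 = 1 then 1 else 0

theorem mulMap_basis (p q : G × F) : mulMap D (basis D p) (basis D q) =
    if M.ract p.1 p.2 = q.1 then (D.σ p.1 p.2 q.2 : k) • basis D (p.1, p.2 * q.2) else 0 := by
  simp [mulMap]

theorem counitMap_basis (p : G × F) :
    counitMap D (basis D p) = if p.1 = 1 then 1 else 0 := by
  simp [counitMap]

theorem mulMap_assoc (a b c : AbelianExt D) :
    mulMap D (mulMap D a b) c = mulMap D a (mulMap D b c) := by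
  induction a using induction_basis with
  | h0 => simp
  | ha x y hx hy => simp only [map_add, LinearMap.add_apply, hx, hy]
  | hs r x hx => simp only [map_smul, LinearMap.smul_apply, hx]
  | hb p =>
    induction b using induction_basis with
    | h0 => simp
    | ha x y hx hy => simp only [map_add, LinearMap.add_apply, hx, hy]
    | hs r x hx => simp only [map_smul, LinearMap.smul_apply, hx]
    | hb q =>
      induction c using induction_basis with
      | h0 => simp
      | ha x y hx hy => simp only [map_add, hx, hy]
      | hs r x hx => simp only [map_smul, hx]
      | hb s =>
        obtain ⟨g, f⟩ := p
        obtain ⟨g', f'⟩ := q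
        obtain ⟨g'', f''⟩ := s
        simp only [mulMap_basis]
        by_cases h : M.ract g f = g'
        · subst h
          by_cases h' : M.ract (M.ract g f) f' = g''
          · have hc := congrArg Units.val (D.σ_cocycle g f f' f'')
            push_cast at hc
            simp [mulMap_basis, h', M.ract_mul, smul_smul, mul_assoc, hc]
          · simp [mulMap_basis, h', M.ract_mul]
        · by_cases h' : M.ract g' f' = g''
          · simp [mulMap_basis, h, h']
          · simp [h, h']

theorem counitMap_mul (a b : AbelianExt D) :
    counitMap D (mulMap D a b) = counitMap D a * counitMap D b := by
  induction a using induction_basis with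
  | h0 => simp
  | ha x y hx hy => simp only [map_add, LinearMap.add_apply, hx, hy, add_mul]
  | hs r x hx => simp only [map_smul, LinearMap.smul_apply, hx, smul_mul_assoc]
  | hb p =>
    induction b using induction_basis with
    | h0 => simp
    | ha x y hx hy => simp only [map_add, hx, hy, mul_add]
    | hs r x hx => simp only [map_smul, hx, mul_smul_comm]
    | hb q =>
      obtain ⟨g, f⟩ := p
      obtain ⟨g', f'⟩ := q
      by_cases h : g = 1
      · subst h
        by_cases h' : (1 : G) = g'
        · simp [mulMap_basis, counitMap_basis, M.one_ract, D.σ_one, ← h']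
        · simp [mulMap_basis, counitMap_basis, M.one_ract, h', Ne.symm h']
      · by_cases h' : M.ract g f = g' <;> simp [mulMap_basis, counitMap_basis, h, h']

end DecidableEq

variable [Fintype G] [DecidableEq G]

theorem unit_mulMap (a : AbelianExt D) : mulMap D (unit D) a = a := by
  induction a using induction_basis with
  | h0 => simp
  | ha x y hx hy => simp only [map_add, hx, hy]
  | hs r x hx => simp only [map_smul, hx]
  | hb p => simp [unit, mulMap_basis, M.ract_one, D.σ_one_left]

theorem mulMap_unit (a : AbelianExt D) : mulMap D a (unit D) = a := by
  induction a using induction_basis with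
  | h0 => simp
  | ha x y hx hy => simp only [map_add, LinearMap.add_apply, hx, hy]
  | hs r x hx => simp only [map_smul, LinearMap.smul_apply, hx]
  | hb p => simp [unit, mulMap_basis, D.σ_one_right]

noncomputable instance : Ring (AbelianExt D) :=
  { (inferInstance : AddCommGroup (AbelianExt D)) with
    mul := fun a b => mulMap D a b
    one := unit D
    mul_assoc := mulMap_assoc D
    one_mul := unit_mulMap D
    mul_one := mulMap_unit D
    left_distrib := fun a b c => map_add (mulMap D a) b c
    right_distrib := fun a b c => LinearMap.map_add₂ (mulMap D) a b c
    zero_mul := fun a => LinearMap.map_zero₂ (mulMap D) a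
    mul_zero := fun a => map_zero (mulMap D a) }

theorem mul_def (a b : AbelianExt D) : a * b = mulMap D a b := rfl

theorem one_def : (1 : AbelianExt D) = unit D := rfl

noncomputable instance : Algebra k (AbelianExt D) :=
  Algebra.ofModule (fun r a b => LinearMap.map_smul₂ (mulMap D) r a b)
    (fun r a b => map_smul (mulMap D a) r b)

theorem mul_basis (p q : G × F) : basis D p * basis D q =
    if M.ract p.1 p.2 = q.1 then (D.σ p.1 p.2 q.2 : k) • basis D (p.1, p.2 * q.2) else 0 :=
  mulMap_basis D p q

noncomputable instance : Coalgebra k (AbelianExt D) where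
  comul := comulMap D
  counit := counitMap D
  coassoc := by
    refine (basis D).ext fun p => ?_
    obtain ⟨g, f⟩ := p
    simp only [LinearMap.coe_comp, LinearEquiv.coe_coe, Function.comp_apply, comulMap_basis,
      map_sum, map_smul, LinearMap.rTensor_tmul, LinearMap.lTensor_tmul, TensorProduct.sum_tmul,
      TensorProduct.tmul_sum, Finset.smul_sum, TensorProduct.smul_tmul',
      TensorProduct.assoc_tmul, smul_smul]
    conv_rhs => rw [Finset.sum_comm]
    refine Finset.sum_congr rfl fun x _ => ?_
    refine Fintype.sum_equiv (Equiv.mulRight x) _ _ fun y => ?_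
    have hc := congrArg Units.val (D.τ_cocycle (g * x⁻¹ * y⁻¹) y x f)
    push_cast at hc
    simp only [inv_mul_cancel_right] at hc
    simp only [Equiv.coe_mulRight, mul_inv_rev, mul_inv_cancel_right, M.mul_lact, ← mul_assoc,
      mul_comm (D.τ (g * x⁻¹) x f : k), hc]
    rw [← TensorProduct.smul_tmul', ← TensorProduct.smul_tmul', ← TensorProduct.smul_tmul',
      TensorProduct.tmul_smul, smul_smul]
  rTensor_counit_comp_comul := by
    refine (basis D).ext fun p => ?_
    obtain ⟨g, f⟩ := p
    simp [comulMap_basis, counitMap_basis, mul_inv_eq_one, TensorProduct.ite_tmul, D.τ_one_left]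
  lTensor_counit_comp_comul := by
    refine (basis D).ext fun p => ?_
    obtain ⟨g, f⟩ := p
    simp [comulMap_basis, counitMap_basis, TensorProduct.tmul_ite, D.τ_one_right, M.one_lact]

theorem comul_basis (p : G × F) : Coalgebra.comul (R := k) (basis D p) =
    ∑ x : G, (D.τ (p.1 * x⁻¹) x p.2 : k) •
      (basis D (p.1 * x⁻¹, M.lact x p.2) ⊗ₜ[k] basis D (x, p.2)) :=
  comulMap_basis D p

theorem counit_basis (p : G × F) :
    Coalgebra.counit (R := k) (basis D p) = if p.1 = 1 then 1 else 0 :=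
  counitMap_basis D p

theorem comul_mul' (a b : AbelianExt D) :
    comulMap D (a * b) = comulMap D a * comulMap D b := by
  induction a using induction_basis with
  | h0 => simp
  | ha x y hx hy => simp only [map_add, add_mul, hx, hy]
  | hs r x hx => simp only [map_smul, smul_mul_assoc, hx]
  | hb p =>
    induction b using induction_basis with
    | h0 => simp
    | ha x y hx hy => simp only [map_add, hx, hy, mul_add]
    | hs r x hx => simp only [map_smul, hx, mul_smul_comm]
    | hb q =>
      obtain ⟨g, f⟩ := p
      obtain ⟨g', f'⟩ := q
      simp only [comulMap_basis, Finset.sum_mul_sum, smul_mul_smul_comm,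
        Algebra.TensorProduct.tmul_mul_tmul, mul_basis]
      have hcond : ∀ x : G, M.ract (g * x⁻¹) (M.lact x f) = g' * (M.ract x f)⁻¹ ↔
          M.ract g f = g' := fun x => by
        rw [eq_mul_inv_iff_mul_eq, ← M.mul_ract, inv_mul_cancel_right]
      have hsum : ∀ x ∈ (Finset.univ : Finset G), (∑ y : G,
          ((D.τ (g * x⁻¹) x f : k) * (D.τ (g' * y⁻¹) y f' : k)) •
          ((if M.ract (g * x⁻¹) (M.lact x f) = g' * y⁻¹ then
              (D.σ (g * x⁻¹) (M.lact x f) (M.lact y f') : k) •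
                basis D (g * x⁻¹, M.lact x f * M.lact y f')
            else 0) ⊗ₜ[k]
            if M.ract x f = y then (D.σ x f f' : k) • basis D (x, f * f') else 0)) =
          if M.ract g f = g' then (D.σ g f f' : k) • (D.τ (g * x⁻¹) x (f * f') : k) •
            (basis D (g * x⁻¹, M.lact x (f * f')) ⊗ₜ[k] basis D (x, f * f')) else 0 := by
        intro x _
        rw [Finset.sum_eq_single (M.ract x f) (fun y _ hy => by simp [Ne.symm hy]) (by simp)]
        simp only [hcond, if_true]
        by_cases h : M.ract g f = g'
        · have hc := congrArg Units.val (D.compat (g * x⁻¹) x f f')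
          push_cast at hc
          have hr : g' * (M.ract x f)⁻¹ = M.ract (g * x⁻¹) (M.lact x f) := ((hcond x).2 h).symm
          simp only [inv_mul_cancel_right] at hc
          simp only [h, if_true, hr, M.lact_mul]
          rw [TensorProduct.tmul_smul, ← TensorProduct.smul_tmul', smul_smul, smul_smul,
            smul_smul, hc]
          congr 1
          ring
        · simp [h]
      rw [Finset.sum_congr rfl hsum]
      by_cases h : M.ract g f = g'
      · simp [h, comulMap_basis, Finset.smul_sum]
      · simp [h]

noncomputable instance : HopfAlgebra k (AbelianExt D) :=
  { Bialgebra.mk' k (AbelianExt D)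
      (by
        change counitMap D (unit D) = 1
        simp [unit, counitMap_basis])
      (fun {a b} => counitMap_mul D a b)
      (by
        change comulMap D (unit D) = 1
        rw [Algebra.TensorProduct.one_def]
        simp only [one_def, unit, map_sum, comulMap_basis, TensorProduct.sum_tmul,
          TensorProduct.tmul_sum, M.lact_one, D.τ_one, Units.val_one, one_smul]
        rw [Finset.sum_comm]
        exact Finset.sum_congr rfl fun x _ =>
          Fintype.sum_equiv (Equiv.mulRight x⁻¹) _ _ fun y => rfl)
      (fun {a b} => comul_mul' D a b) with
    antipode := antipodeMap D
    mul_antipode_rTensor_comul := by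
      refine (basis D).ext fun p => ?_
      obtain ⟨g, f⟩ := p
      change LinearMap.mul' k _ ((antipodeMap D).rTensor _ (comulMap D _)) =
        algebraMap k _ (counitMap D _)
      simp only [comulMap_basis, counitMap_basis, map_sum, map_smul, LinearMap.rTensor_tmul,
        antipodeMap_basis, LinearMap.mul'_apply, smul_mul_assoc, mul_basis, smul_smul]
      have hcond : ∀ x : G,
          M.ract (M.ract (g * x⁻¹) (M.lact x f))⁻¹ (M.lact (g * x⁻¹) (M.lact x f))⁻¹ = x ↔
            g = 1 := fun x => by
        rw [M.ract_inv, M.ract_ract_inv, mul_inv_rev, inv_inv, mul_eq_left, inv_eq_one]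
      simp only [hcond]
      by_cases hg : g = 1
      · subst hg
        simp only [if_true, map_one, one_def, unit, one_mul, inv_inv, smul_smul,
          ← M.mul_lact, inv_mul_cancel, M.one_lact]
        refine Fintype.sum_equiv ⟨fun x => M.ract x f, fun x => M.ract x f⁻¹,
          fun x => M.ract_ract_inv x f, fun x => M.ract_inv_ract x f⟩ _ _ fun x => ?_
        have h1 : (M.ract x⁻¹ (M.lact x f))⁻¹ = M.ract x f := by
          rw [← M.ract_inv, inv_inv]
        have h2 : D.τ x⁻¹ x f = D.τ x x⁻¹ (M.lact x f) := by
          have := D.τ_cocycle x x⁻¹ x f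
          rw [mul_inv_cancel, inv_mul_cancel, D.τ_one_left, D.τ_one_right] at this
          simpa using this.symm
        have h3 : D.σ (M.ract x f) f⁻¹ f = D.σ x f f⁻¹ := by
          have := D.σ_cocycle x f f⁻¹ f
          rw [mul_inv_cancel, inv_mul_cancel, D.σ_one_left, D.σ_one_right] at this
          simpa using this
        rw [h1, h2, h3]
        simp [mul_comm, mul_left_comm]
      · simp [hg]
    mul_antipode_lTensor_comul := by
      refine (basis D).ext fun p => ?_
      obtain ⟨g, f⟩ := p
      change LinearMap.mul' k _ ((antipodeMap D).lTensor _ (comulMap D _)) =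
        algebraMap k _ (counitMap D _)
      simp only [comulMap_basis, counitMap_basis, map_sum, map_smul, LinearMap.lTensor_tmul,
        antipodeMap_basis, LinearMap.mul'_apply, mul_smul_comm, mul_basis, smul_smul]
      have hcond : ∀ x : G, M.ract (g * x⁻¹) (M.lact x f) = (M.ract x f)⁻¹ ↔ g = 1 := fun x => by
        rw [eq_inv_iff_mul_eq_one, ← M.mul_ract, inv_mul_cancel_right]
        refine ⟨fun h => ?_, fun h => by rw [h, M.one_ract]⟩
        rw [← M.ract_ract_inv g f, h, M.one_ract]
      simp only [hcond]
      by_cases hg : g = 1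
      · subst hg
        simp only [if_true, map_one, one_def, unit, one_mul, smul_smul, mul_inv_cancel]
        refine Fintype.sum_equiv (Equiv.inv G) _ _ fun x => ?_
        simp [mul_comm, mul_left_comm]
      · simp [hg] }

end AbelianExt

section Comodules

/-- A finite-dimensional right comodule `(M, ρ)` over a coalgebra `C` over a field `k`:
`(ρ ⊗ id) ρ = (id ⊗ Δ) ρ` and `(id ⊗ ε) ρ = id`. -/
structure FDComod (k : Type u) (C : Type v) [Field k] [AddCommGroup C] [Module k C]
    [Coalgebra k C] : Type (max (u + 1) v) where
  carrier : Type u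
  [addCommGroup : AddCommGroup carrier]
  [module : Module k carrier]
  [finite : Module.Finite k carrier]
  coact : carrier →ₗ[k] carrier ⊗[k] C
  coassoc : ∀ m, TensorProduct.assoc k carrier C C (coact.rTensor C (coact m)) =
    (Coalgebra.comul (R := k) (A := C)).lTensor carrier (coact m)
  counit_coact : ∀ m, TensorProduct.rid k carrier
    ((Coalgebra.counit (R := k) (A := C)).lTensor carrier (coact m)) = m

attribute [instance] FDComod.addCommGroup FDComod.module FDComod.finite

namespace FDComod

section Coalgebra

variable {k : Type u} {C : Type v} [Field k] [AddCommGroup C] [Module k C] [Coalgebra k C]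

/-- A linear map `f : M → N` is a morphism of right comodules if `ρ_N f = (f ⊗ id) ρ_M`. -/
def IsHom {M N : FDComod k C} (f : M.carrier →ₗ[k] N.carrier) : Prop :=
  ∀ m, N.coact (f m) = f.rTensor C (M.coact m)

/-- `M` and `N` are isomorphic as right comodules. -/
def Iso (M N : FDComod k C) : Prop :=
  ∃ e : M.carrier ≃ₗ[k] N.carrier, IsHom (e : M.carrier →ₗ[k] N.carrier)

/-- `0 → X → Y → Z → 0` is a short exact sequence of right comodules, for some maps. -/
def ShortExact (X Y Z : FDComod k C) : Prop :=
  ∃ (f : X.carrier →ₗ[k] Y.carrier) (g : Y.carrier →ₗ[k] Z.carrier), IsHom f ∧ IsHom g ∧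
    Function.Injective f ∧ Function.Exact f g ∧ Function.Surjective g

theorem Iso.refl (M : FDComod k C) : Iso M M :=
  ⟨LinearEquiv.refl k _, fun m => by simp [LinearMap.rTensor]⟩

theorem Iso.symm {M N : FDComod k C} (h : Iso M N) : Iso N M := by
  obtain ⟨e, he⟩ := h
  refine ⟨e.symm, fun n => ?_⟩
  have := he (e.symm n)
  simp only [LinearEquiv.coe_coe, LinearEquiv.apply_symm_apply] at this
  rw [this]
  change _ = e.symm.toLinearMap.rTensor C (e.toLinearMap.rTensor C (M.coact (e.symm n)))
  rw [← LinearMap.rTensor_comp_apply]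
  simp

theorem Iso.trans {M N P : FDComod k C} (h : Iso M N) (h' : Iso N P) : Iso M P := by
  obtain ⟨e, he⟩ := h
  obtain ⟨e', he'⟩ := h'
  refine ⟨e.trans e', fun m => ?_⟩
  have h1 := he m
  have h2 := he' (e m)
  simp only [LinearEquiv.coe_coe] at h1 h2
  simp only [LinearEquiv.coe_coe, LinearEquiv.coe_trans,
    LinearMap.rTensor_comp, LinearMap.comp_apply]
  rw [h2, h1]

variable (k C) in
/-- Isomorphism of finite-dimensional right comodules. -/
def isoSetoid : Setoid (FDComod k C) where
  r := Iso
  iseqv := ⟨Iso.refl, Iso.symm, Iso.trans⟩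

end Coalgebra

section PairMul

variable {k : Type u} [Field k] {M N P : Type u} [AddCommGroup M] [Module k M] [AddCommGroup N]
  [Module k N] [AddCommGroup P] [Module k P]
variable {A : Type v} [Ring A] [Algebra k A] {B : Type w} [Ring B] [Algebra k B]

/-- The map `(M ⊗ A) ⊗ (N ⊗ A) → (M ⊗ N) ⊗ A`, `(m ⊗ a) ⊗ (n ⊗ b) ↦ (m ⊗ n) ⊗ a b`. -/
noncomputable def pairMul (k : Type u) [Field k] (M N : Type u) [AddCommGroup M] [Module k M]
    [AddCommGroup N] [Module k N] (A : Type v) [Ring A] [Algebra k A] :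
    (M ⊗[k] A) ⊗[k] (N ⊗[k] A) →ₗ[k] (M ⊗[k] N) ⊗[k] A :=
  (LinearMap.mul' k A).lTensor (M ⊗[k] N) ∘ₗ
    (TensorProduct.tensorTensorTensorComm k M A N A).toLinearMap

@[simp]
theorem pairMul_tmul (m : M) (a : A) (n : N) (b : A) :
    pairMul k M N A ((m ⊗ₜ a) ⊗ₜ (n ⊗ₜ b)) = (m ⊗ₜ n) ⊗ₜ (a * b) := by
  simp [pairMul]

theorem pairMul_lTensor (φ : A →ₗ[k] B) (hφ : ∀ a b, φ (a * b) = φ a * φ b)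
    (t : M ⊗[k] A) (s : N ⊗[k] A) :
    φ.lTensor (M ⊗[k] N) (pairMul k M N A (t ⊗ₜ s)) =
      pairMul k M N B (φ.lTensor M t ⊗ₜ φ.lTensor N s) := by
  induction t with
  | zero => simp
  | add x y hx hy => simp only [TensorProduct.add_tmul, map_add, hx, hy]
  | tmul m a =>
    induction s with
    | zero => simp
    | add x y hx hy => simp only [TensorProduct.tmul_add, map_add, hx, hy]
    | tmul n b => simp [hφ]

theorem pairMul_rTensor {M' N' : Type u} [AddCommGroup M'] [Module k M'] [AddCommGroup N']
    [Module k N'] (f : M →ₗ[k] M') (g : N →ₗ[k] N') (t : M ⊗[k] A) (s : N ⊗[k] A) :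
    (TensorProduct.map f g).rTensor A (pairMul k M N A (t ⊗ₜ s)) =
      pairMul k M' N' A (f.rTensor A t ⊗ₜ g.rTensor A s) := by
  induction t with
  | zero => simp
  | add x y hx hy => simp only [TensorProduct.add_tmul, map_add, hx, hy]
  | tmul m a =>
    induction s with
    | zero => simp
    | add x y hx hy => simp only [TensorProduct.tmul_add, map_add, hx, hy]
    | tmul n b => simp

theorem pairMul_assoc (t : M ⊗[k] A) (s : N ⊗[k] A) (r : P ⊗[k] A) :
    (TensorProduct.assoc k M N P).toLinearMap.rTensor A
        (pairMul k (M ⊗[k] N) P A (pairMul k M N A (t ⊗ₜ s) ⊗ₜ r)) =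
      pairMul k M (N ⊗[k] P) A (t ⊗ₜ pairMul k N P A (s ⊗ₜ r)) := by
  induction t with
  | zero => simp
  | add x y hx hy => simp only [TensorProduct.add_tmul, map_add, hx, hy]
  | tmul m a =>
    induction s with
    | zero => simp
    | add x y hx hy => simp only [TensorProduct.tmul_add, TensorProduct.add_tmul, map_add, hx, hy]
    | tmul n b =>
      induction r with
      | zero => simp
      | add x y hx hy => simp only [TensorProduct.tmul_add, map_add, hx, hy]
      | tmul p c => simp [mul_assoc]

theorem pairMul_one_left (s : N ⊗[k] A) :
    (TensorProduct.lid k N).toLinearMap.rTensor A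
        (pairMul k k N A (((1 : k) ⊗ₜ[k] (1 : A)) ⊗ₜ s)) = s := by
  induction s with
  | zero => simp
  | add x y hx hy => simp only [TensorProduct.tmul_add, map_add, hx, hy]
  | tmul n b => simp

theorem pairMul_one_right (t : M ⊗[k] A) :
    (TensorProduct.rid k M).toLinearMap.rTensor A
        (pairMul k M k A (t ⊗ₜ ((1 : k) ⊗ₜ[k] (1 : A)))) = t := by
  induction t with
  | zero => simp
  | add x y hx hy => simp only [TensorProduct.add_tmul, map_add, hx, hy]
  | tmul n b => simp

theorem pairMul_coassoc_aux (t : M ⊗[k] A) (s : N ⊗[k] A) (a b : A) :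
    TensorProduct.assoc k (M ⊗[k] N) A A (pairMul k M N A (t ⊗ₜ s) ⊗ₜ (a * b)) =
      pairMul k M N (A ⊗[k] A)
        (TensorProduct.assoc k M A A (t ⊗ₜ a) ⊗ₜ TensorProduct.assoc k N A A (s ⊗ₜ b)) := by
  induction t with
  | zero => simp
  | add x y hx hy => simp only [TensorProduct.add_tmul, map_add, hx, hy]
  | tmul m c =>
    induction s with
    | zero => simp
    | add x y hx hy => simp only [TensorProduct.tmul_add, TensorProduct.add_tmul, map_add, hx, hy]
    | tmul n d => simp

theorem pairMul_coassoc (f : M →ₗ[k] M ⊗[k] A) (g : N →ₗ[k] N ⊗[k] A)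
    (t : M ⊗[k] A) (s : N ⊗[k] A) :
    TensorProduct.assoc k (M ⊗[k] N) A A
        ((pairMul k M N A ∘ₗ TensorProduct.map f g).rTensor A (pairMul k M N A (t ⊗ₜ s))) =
      pairMul k M N (A ⊗[k] A)
        (TensorProduct.assoc k M A A (f.rTensor A t) ⊗ₜ
          TensorProduct.assoc k N A A (g.rTensor A s)) := by
  induction t with
  | zero => simp
  | add x y hx hy => simp only [TensorProduct.add_tmul, map_add, hx, hy]
  | tmul m a =>
    induction s with
    | zero => simp
    | add x y hx hy => simp only [TensorProduct.tmul_add, map_add, hx, hy]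
    | tmul n b => simpa using pairMul_coassoc_aux (f m) (g n) a b

theorem pairMul_rid (t : M ⊗[k] k) (s : N ⊗[k] k) :
    TensorProduct.rid k (M ⊗[k] N) (pairMul k M N k (t ⊗ₜ s)) =
      TensorProduct.rid k M t ⊗ₜ TensorProduct.rid k N s := by
  induction t with
  | zero => simp
  | add x y hx hy => simp only [TensorProduct.add_tmul, map_add, hx, hy]
  | tmul m a =>
    induction s with
    | zero => simp
    | add x y hx hy => simp only [TensorProduct.tmul_add, map_add, hx, hy]
    | tmul n b => simp [TensorProduct.smul_tmul', TensorProduct.tmul_smul, smul_smul, mul_comm]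

variable (ρ : M →ₗ[k] M ⊗[k] A) (ρ' : N →ₗ[k] N ⊗[k] A) (ρ'' : P →ₗ[k] P ⊗[k] A)

/-- The tensor product `m ⊗ n ↦ ∑ (m₍₀₎ ⊗ n₍₀₎) ⊗ m₍₁₎ n₍₁₎` of two coactions. -/
noncomputable def pairCoact : M ⊗[k] N →ₗ[k] (M ⊗[k] N) ⊗[k] A :=
  pairMul k M N A ∘ₗ TensorProduct.map ρ ρ'

theorem pairCoact_map {M' N' : Type u} [AddCommGroup M'] [Module k M'] [AddCommGroup N']
    [Module k N'] (π : M' →ₗ[k] M' ⊗[k] A) (π' : N' →ₗ[k] N' ⊗[k] A)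
    (f : M →ₗ[k] M') (g : N →ₗ[k] N') (hf : ∀ m, π (f m) = f.rTensor A (ρ m))
    (hg : ∀ n, π' (g n) = g.rTensor A (ρ' n)) (x : M ⊗[k] N) :
    pairCoact π π' (TensorProduct.map f g x) =
      (TensorProduct.map f g).rTensor A (pairCoact ρ ρ' x) := by
  induction x with
  | zero => simp
  | add x y hx hy => simp only [map_add, hx, hy]
  | tmul m n => simp [pairCoact, pairMul_rTensor, hf, hg]

theorem pairCoact_assoc (x : (M ⊗[k] N) ⊗[k] P) :
    pairCoact ρ (pairCoact ρ' ρ'') (TensorProduct.assoc k M N P x) =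
      (TensorProduct.assoc k M N P).toLinearMap.rTensor A
        (pairCoact (pairCoact ρ ρ') ρ'' x) := by
  induction x with
  | zero => simp
  | add x y hx hy => simp only [map_add, hx, hy]
  | tmul x p =>
    induction x with
    | zero => simp
    | add x y hx hy => simp only [TensorProduct.add_tmul, map_add, hx, hy]
    | tmul m n => simp [pairCoact, pairMul_assoc]

theorem pairCoact_lid (x : k ⊗[k] M) :
    ρ (TensorProduct.lid k M x) = (TensorProduct.lid k M).toLinearMap.rTensor A
      (pairCoact ((TensorProduct.mk k k A).flip 1) ρ x) := by
  induction x with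
  | zero => simp
  | add x y hx hy => simp only [map_add, hx, hy]
  | tmul r m =>
    rw [← mul_one r, ← smul_eq_mul, TensorProduct.smul_tmul, TensorProduct.lid_tmul, one_smul]
    exact (pairMul_one_left (ρ (r • m))).symm

theorem pairCoact_rid (x : M ⊗[k] k) :
    ρ (TensorProduct.rid k M x) = (TensorProduct.rid k M).toLinearMap.rTensor A
      (pairCoact ρ ((TensorProduct.mk k k A).flip 1) x) := by
  induction x with
  | zero => simp
  | add x y hx hy => simp only [map_add, hx, hy]
  | tmul m r =>
    rw [← mul_one r, ← smul_eq_mul, ← TensorProduct.smul_tmul, TensorProduct.rid_tmul, one_smul]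
    exact (pairMul_one_right (ρ (r • m))).symm

end PairMul

section Bialgebra

variable {k : Type u} {H : Type v} [Field k] [Ring H] [Bialgebra k H]

/-- The tensor product of right comodules over a bialgebra:
`ρ(m ⊗ n) = ∑ (m₍₀₎ ⊗ n₍₀₎) ⊗ m₍₁₎ n₍₁₎`. -/
noncomputable def tensor (M N : FDComod k H) : FDComod k H where
  carrier := M.carrier ⊗[k] N.carrier
  coact := pairCoact M.coact N.coact
  coassoc := fun x => by
    induction x with
    | zero => simp
    | add x y hx hy => simp only [map_add, hx, hy]
    | tmul m n =>
      rw [pairCoact, LinearMap.comp_apply, TensorProduct.map_tmul, pairMul_coassoc, M.coassoc, N.coassoc,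
        pairMul_lTensor _ Bialgebra.comul_mul]
  counit_coact := fun x => by
    induction x with
    | zero => simp
    | add x y hx hy => simp only [map_add, hx, hy]
    | tmul m n =>
      rw [pairCoact, LinearMap.comp_apply, TensorProduct.map_tmul,
        pairMul_lTensor _ Bialgebra.counit_mul,        pairMul_rid, M.counit_coact, N.counit_coact]

variable (k H) in
/-- The trivial comodule `k` with `ρ(1) = 1 ⊗ 1`. -/
noncomputable def trivial : FDComod k H where
  carrier := k
  coact := (TensorProduct.mk k k H).flip 1
  coassoc := fun m => by
    simp [Bialgebra.comul_one, Algebra.TensorProduct.one_def]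
  counit_coact := fun m => by simp

theorem IsHom.tensor {M M' N N' : FDComod k H} {f : M.carrier →ₗ[k] M'.carrier}
    {g : N.carrier →ₗ[k] N'.carrier} (hf : IsHom f) (hg : IsHom g) :
    IsHom (M := FDComod.tensor M N) (N := FDComod.tensor M' N') (TensorProduct.map f g) :=
  pairCoact_map _ _ _ _ f g hf hg

theorem Iso.tensor {M M' N N' : FDComod k H} (h : Iso M M') (h' : Iso N N') :
    Iso (FDComod.tensor M N) (FDComod.tensor M' N') := by
  obtain ⟨e, he⟩ := h
  obtain ⟨e', he'⟩ := h'
  exact ⟨TensorProduct.congr e e', IsHom.tensor he he'⟩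

theorem tensor_assoc (M N P : FDComod k H) :
    Iso (tensor (tensor M N) P) (tensor M (tensor N P)) :=
  ⟨TensorProduct.assoc k M.carrier N.carrier P.carrier,
    pairCoact_assoc M.coact N.coact P.coact⟩

theorem trivial_tensor (M : FDComod k H) : Iso (tensor (trivial k H) M) M :=
  ⟨TensorProduct.lid k M.carrier, pairCoact_lid M.coact⟩

theorem tensor_trivial (M : FDComod k H) : Iso (tensor M (trivial k H)) M :=
  ⟨TensorProduct.rid k M.carrier, pairCoact_rid M.coact⟩

theorem ShortExact.tensor_left {X Y Z : FDComod k H} (N : FDComod k H) (h : ShortExact X Y Z) :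
    ShortExact (tensor N X) (tensor N Y) (tensor N Z) := by
  obtain ⟨f, g, hf, hg, hi, he, hs⟩ := h
  have hN : IsHom (LinearMap.id : N.carrier →ₗ[k] N.carrier) := fun m => by simp
  exact ⟨f.lTensor N.carrier, g.lTensor N.carrier, hN.tensor hf, hN.tensor hg,
    Module.Flat.lTensor_preserves_injective_linearMap f hi, lTensor_exact N.carrier he hs,
    LinearMap.lTensor_surjective N.carrier hs⟩

theorem ShortExact.tensor_right {X Y Z : FDComod k H} (N : FDComod k H) (h : ShortExact X Y Z) :
    ShortExact (tensor X N) (tensor Y N) (tensor Z N) := by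
  obtain ⟨f, g, hf, hg, hi, he, hs⟩ := h
  have hN : IsHom (LinearMap.id : N.carrier →ₗ[k] N.carrier) := fun m => by simp
  exact ⟨f.rTensor N.carrier, g.rTensor N.carrier, hf.tensor hN, hg.tensor hN,
    Module.Flat.rTensor_preserves_injective_linearMap f hi, rTensor_exact N.carrier he hs,
    LinearMap.rTensor_surjective N.carrier hs⟩

end Bialgebra

end FDComod

variable (k : Type u) (H : Type v) [Field k] [Ring H] [Bialgebra k H]

/-- The isomorphism classes of finite-dimensional right `H`-comodules. -/
def ComodClass : Type (max (u + 1) v) := Quotient (FDComod.isoSetoid k H)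

variable {k H} in
/-- The isomorphism class of a finite-dimensional right `H`-comodule. -/
def ComodClass.mk (M : FDComod k H) : ComodClass k H := Quotient.mk (FDComod.isoSetoid k H) M

/-- Isomorphism classes multiply by `[M] [N] = [M ⊗ N]`, with unit the class of the trivial
comodule. -/
noncomputable instance : Monoid (ComodClass k H) where
  mul := Quotient.map₂ FDComod.tensor fun _ _ h _ _ h' => FDComod.Iso.tensor h h'
  one := ComodClass.mk (FDComod.trivial k H)
  mul_assoc := by
    rintro ⟨M⟩ ⟨N⟩ ⟨P⟩
    exact Quotient.sound (FDComod.tensor_assoc M N P)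
  one_mul := by
    rintro ⟨M⟩
    exact Quotient.sound (FDComod.trivial_tensor M)
  mul_one := by
    rintro ⟨M⟩
    exact Quotient.sound (FDComod.tensor_trivial M)

theorem ComodClass.mk_mul_mk (M N : FDComod k H) :
    ComodClass.mk M * ComodClass.mk N = ComodClass.mk (FDComod.tensor M N) := rfl

/-- The elements `[Y] - [X] - [Z]` of the free abelian group on the isomorphism classes, one for
every short exact sequence `0 → X → Y → Z → 0`. -/
def grothendieckRelations : Set (FreeAbelianGroup (ComodClass k H)) :=
  {r | ∃ X Y Z : FDComod k H, FDComod.ShortExact X Y Z ∧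
    r = FreeAbelianGroup.of (ComodClass.mk Y) - FreeAbelianGroup.of (ComodClass.mk X) -
      FreeAbelianGroup.of (ComodClass.mk Z)}

theorem mul_mem_closure_grothendieckRelations (a x : FreeAbelianGroup (ComodClass k H))
    (hx : x ∈ AddSubgroup.closure (grothendieckRelations k H)) :
    a * x ∈ AddSubgroup.closure (grothendieckRelations k H) := by
  induction a using FreeAbelianGroup.induction_on with
  | zero => rw [zero_mul]; exact zero_mem _
  | neg a h => rw [neg_mul]; exact neg_mem h
  | add a b ha hb => rw [add_mul]; exact add_mem ha hb
  | of a =>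
    obtain ⟨N, rfl⟩ : ∃ N, ComodClass.mk N = a := Quotient.exists_rep a
    induction hx using AddSubgroup.closure_induction with
    | zero => rw [mul_zero]; exact zero_mem _
    | neg a _ h => rw [mul_neg]; exact neg_mem h
    | add a b _ _ ha hb => rw [mul_add]; exact add_mem ha hb
    | mem r hr =>
      obtain ⟨X, Y, Z, h, rfl⟩ := hr
      simp only [mul_sub, FreeAbelianGroup.of_mul_of, ComodClass.mk_mul_mk]
      exact AddSubgroup.subset_closure ⟨_, _, _, h.tensor_left N, rfl⟩

theorem closure_grothendieckRelations_mul_mem (a x : FreeAbelianGroup (ComodClass k H))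
    (hx : x ∈ AddSubgroup.closure (grothendieckRelations k H)) :
    x * a ∈ AddSubgroup.closure (grothendieckRelations k H) := by
  induction a using FreeAbelianGroup.induction_on with
  | zero => rw [mul_zero]; exact zero_mem _
  | neg a h => rw [mul_neg]; exact neg_mem h
  | add a b ha hb => rw [mul_add]; exact add_mem ha hb
  | of a =>
    obtain ⟨N, rfl⟩ : ∃ N, ComodClass.mk N = a := Quotient.exists_rep a
    induction hx using AddSubgroup.closure_induction with
    | zero => rw [zero_mul]; exact zero_mem _
    | neg a _ h => rw [neg_mul]; exact neg_mem h
    | add a b _ _ ha hb => rw [add_mul]; exact add_mem ha hb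
    | mem r hr =>
      obtain ⟨X, Y, Z, h, rfl⟩ := hr
      simp only [sub_mul, FreeAbelianGroup.of_mul_of, ComodClass.mk_mul_mk]
      exact AddSubgroup.subset_closure ⟨_, _, _, h.tensor_right N, rfl⟩

/-- The subgroup of the free abelian group on the isomorphism classes generated by all
`[Y] - [X] - [Z]` for short exact sequences `0 → X → Y → Z → 0`; it is a two-sided ideal for the
product `[M] [N] = [M ⊗ N]`. -/
def grothendieckIdeal : Ideal (FreeAbelianGroup (ComodClass k H)) where
  carrier := AddSubgroup.closure (grothendieckRelations k H)
  add_mem' := add_mem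
  zero_mem' := zero_mem _
  smul_mem' := mul_mem_closure_grothendieckRelations k H

instance : (grothendieckIdeal k H).IsTwoSided :=
  ⟨fun {a} b ha => closure_grothendieckRelations_mul_mem k H b a ha⟩

/-- The Grothendieck ring `Gr(H-comod)` of the category of finite-dimensional right
`H`-comodules. -/
abbrev GrothendieckRing : Type (max (u + 1) v) :=
  FreeAbelianGroup (ComodClass k H) ⧸ grothendieckIdeal k H

end Comodules

/-! Write `g` for the generator of the group of order two. Its right action by `F` is trivial, since
each `f` permutes two elements and fixes `1`. Hence `g ▷` is an automorphism of `F`, and its fixed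
points `S` form a subgroup. For `f` in `S`, choose a square root `c` of `τ(g, g; f)`; then `p_1 # f
+ c (p_g # f)` is group-like in `H` (`AbelianExt.isGroupLikeElem`).

It remains to see that commutativity of the Grothendieck ring forces group-likes to commute
(`IsGroupLikeElem.mul_comm_of_grothendieckRing`). A functional `φ` on `H` acts on every comodule,
and the trace of this action is additive on short exact sequences, so it is an additive invariant of
classes in the ring. On the tensor product of the one-dimensional comodules of group-likes `a` and
`b` its value is `φ(ab)`. Thus `φ(ab) = φ(ba)` for all `φ`, and functionals separate points. No
classification of simple comodules enters.

Finally, the `p_1` part of a product of two such group-likes is `p_1 # ff'`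
(`AbelianExt.repr_mul_apply_one`), so commuting group-likes give `ff' = f'f`. -/

namespace LinearMap

/-! ### Traces along short exact sequences -/

/-- The trace is additive on endomorphisms of short exact sequences. -/
theorem trace_eq_add_of_shortExact {k X Y Z : Type*} [Field k] [AddCommGroup X] [Module k X]
    [Module.Finite k X] [AddCommGroup Y] [Module k Y] [Module.Finite k Y] [AddCommGroup Z]
    [Module k Z] [Module.Finite k Z] {f : X →ₗ[k] Y} {g : Y →ₗ[k] Z}
    (hf : Function.Injective f) (hfg : Function.Exact f g) (hg : Function.Surjective g)
    {a : X →ₗ[k] X} {b : Y →ₗ[k] Y} {c : Z →ₗ[k] Z} (hab : b ∘ₗ f = f ∘ₗ a)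
    (hbc : c ∘ₗ g = g ∘ₗ b) : trace k Y b = trace k X a + trace k Z c := by
  obtain ⟨r, hr⟩ := f.exists_leftInverse_of_injective (ker_eq_bot.2 hf)
  obtain ⟨s, hs⟩ := g.exists_rightInverse_of_surjective (range_eq_top.2 hg)
  have hrf : ∀ x, r (f x) = x := fun x => congr($hr x)
  have hgs : ∀ z, g (s z) = z := fun z => congr($hs z)
  -- The correction `id - s ∘ g` turns `r` into the retraction of `f` that vanishes on the image of
  -- `s`, so that `f` and `s` together decompose `Y`.
  have hsplit : f ∘ₗ (r ∘ₗ (id - s ∘ₗ g)) + s ∘ₗ g = id := by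
    ext y
    obtain ⟨x, hx⟩ := (hfg (y - s (g y))).1 (by rw [map_sub, hgs, sub_self])
    have hy : y = f x + s (g y) := by rw [hx, sub_add_cancel]
    simp only [add_apply, comp_apply, sub_apply, id_apply, ← hx, hrf]
    exact hy.symm
  have hret : (r ∘ₗ (id - s ∘ₗ g)) ∘ₗ f = id := by
    ext x
    simp [hfg.apply_apply_eq_zero, hrf]
  -- Cyclicity of the trace brings the two summands back to `X` and `Z`, so `r` and `s` need not
  -- commute with the endomorphisms.
  calc trace k Y b = trace k Y (b ∘ₗ (f ∘ₗ (r ∘ₗ (id - s ∘ₗ g)) + s ∘ₗ g)) := by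
        rw [hsplit, comp_id]
    _ = trace k Y (f ∘ₗ (a ∘ₗ (r ∘ₗ (id - s ∘ₗ g)))) + trace k Y ((b ∘ₗ s) ∘ₗ g) := by
        rw [comp_add, map_add, ← comp_assoc _ f b, hab, comp_assoc, comp_assoc]
    _ = trace k X a + trace k Z c := by
        rw [trace_comp_comm', trace_comp_comm' g, comp_assoc, hret, comp_id,
          ← comp_assoc s b g, ← hbc, comp_assoc, hs, comp_id]

end LinearMap

/-! ### Characters of comodules -/

namespace FDComod

section Coalgebra

variable {k : Type u} {C : Type v} [Field k] [AddCommGroup C] [Module k C] [Coalgebra k C]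

/-- The endomorphism `m ↦ ∑ φ(m₍₁₎) m₍₀₎` by which a functional `φ` on the coalgebra acts on a
comodule. -/
noncomputable def act (M : FDComod k C) (φ : C →ₗ[k] k) : M.carrier →ₗ[k] M.carrier :=
  (TensorProduct.rid k M.carrier).toLinearMap ∘ₗ φ.lTensor M.carrier ∘ₗ M.coact

/-- A morphism touches only the comodule leg of the coaction and `φ` only the coalgebra leg. -/
theorem IsHom.act_comp {M N : FDComod k C} {f : M.carrier →ₗ[k] N.carrier} (hf : IsHom f)
    (φ : C →ₗ[k] k) : N.act φ ∘ₗ f = f ∘ₗ M.act φ := by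
  ext m
  simp only [act, LinearMap.comp_apply, hf m]
  induction M.coact m with
  | zero => simp
  | add x y hx hy => simp only [map_add, hx, hy]
  | tmul m c => simp

/-- The value `tr(∑ φ(m₍₁₎) m₍₀₎)` at `φ` of the character of a comodule. -/
noncomputable def character (φ : C →ₗ[k] k) (M : FDComod k C) : k :=
  LinearMap.trace k M.carrier (M.act φ)

theorem ShortExact.character_eq {X Y Z : FDComod k C} (h : ShortExact X Y Z) (φ : C →ₗ[k] k) :
    character φ Y = character φ X + character φ Z := by
  obtain ⟨f, g, hf, hg, hi, he, hs⟩ := h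
  exact LinearMap.trace_eq_add_of_shortExact hi he hs (hf.act_comp φ) (hg.act_comp φ)

/-- The two actions are conjugate. This lets the character descend to isomorphism classes. -/
theorem Iso.character_eq {M N : FDComod k C} (h : Iso M N) (φ : C →ₗ[k] k) :
    character φ M = character φ N := by
  obtain ⟨e, he⟩ := h
  have h1 : N.act φ = e.conj (M.act φ) := by
    rw [LinearEquiv.conj_apply, ← he.act_comp φ]
    ext n
    simp
  rw [character, character, h1, LinearMap.trace_conj']

/-- The one-dimensional comodule given by a group-like element. -/
noncomputable def ofGroupLike {a : C} (ha : IsGroupLikeElem k a) : FDComod k C where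
  carrier := k
  coact := (TensorProduct.mk k k C).flip a
  coassoc := fun m => by simp [ha.comul_eq_tmul_self]
  counit_coact := fun m => by simp [ha.counit_eq_one]

end Coalgebra

variable {k : Type u} {H : Type v} [Field k] [Ring H] [Bialgebra k H]

/-- The coaction sends `x ⊗ y` to `(x ⊗ y) ⊗ ab`, so `φ` acts on a line as the scalar `φ(ab)`. -/
theorem character_tensor_ofGroupLike {a b : H} (ha : IsGroupLikeElem k a)
    (hb : IsGroupLikeElem k b) (φ : H →ₗ[k] k) :
    character φ (tensor (ofGroupLike ha) (ofGroupLike hb)) = φ (a * b) := by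
  have h : (tensor (ofGroupLike ha) (ofGroupLike hb)).act φ = φ (a * b) • LinearMap.id := by
    have h0 (x y : k) : TensorProduct.rid k (k ⊗[k] k) (φ.lTensor (k ⊗[k] k)
        (pairMul k k k H ((x ⊗ₜ[k] a) ⊗ₜ[k] (y ⊗ₜ[k] b)))) = φ (a * b) • (x ⊗ₜ[k] y) := by
      simp
    -- On pure tensors the action of `φ` unfolds by definition to the expression in `h0`.
    exact TensorProduct.ext' h0
  have h1 : Module.finrank k (tensor (ofGroupLike ha) (ofGroupLike hb)).carrier = 1 :=
    (Module.finrank_tensorProduct (R := k) (S := k) (M := k) (M' := k)).trans (by simp)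
  rw [character, h, map_smul, LinearMap.trace_id, h1, Nat.cast_one, smul_eq_mul, mul_one]

end FDComod

/-! ### Group-likes and the Grothendieck ring -/

section GrothendieckRing

variable {k : Type u} {H : Type v} [Field k] [Ring H] [Bialgebra k H]

/-- The additive extension of `FDComod.character φ` to the free abelian group on the isomorphism
classes of comodules. -/
noncomputable def characterHom (φ : H →ₗ[k] k) : FreeAbelianGroup (ComodClass k H) →+ k :=
  FreeAbelianGroup.lift (Quotient.lift (FDComod.character φ) fun _ _ h => h.character_eq φ)

theorem characterHom_of_mk (φ : H →ₗ[k] k) (M : FDComod k H) :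
    characterHom φ (FreeAbelianGroup.of (ComodClass.mk M)) = FDComod.character φ M :=
  FreeAbelianGroup.lift_apply_of _ _

/-- The ideal is by construction only an additive closure, so additivity on short exact sequences
suffices; the character need not be multiplicative. -/
theorem characterHom_eq_zero (φ : H →ₗ[k] k) {x : FreeAbelianGroup (ComodClass k H)}
    (hx : x ∈ grothendieckIdeal k H) : characterHom φ x = 0 := by
  suffices h : AddSubgroup.closure (grothendieckRelations k H) ≤ (characterHom φ).ker from h hx
  rw [AddSubgroup.closure_le]
  rintro _ ⟨X, Y, Z, h, rfl⟩
  simp [characterHom_of_mk, h.character_eq φ]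

/-- If the Grothendieck ring of the comodules over a bialgebra is commutative, then the group-like
elements commute with each other. -/
theorem IsGroupLikeElem.mul_comm_of_grothendieckRing
    (hcomm : ∀ x y : GrothendieckRing k H, x * y = y * x) {a b : H} (ha : IsGroupLikeElem k a)
    (hb : IsGroupLikeElem k b) : a * b = b * a := by
  -- Linear functionals separate the points of a vector space, which reduces the claim to `φ(ab) =
  -- φ(ba)`.
  refine Module.eval_apply_injective k (LinearMap.ext fun φ => ?_)
  rw [Module.Dual.eval_apply, Module.Dual.eval_apply]
  let A := FreeAbelianGroup.of (ComodClass.mk (FDComod.ofGroupLike ha))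
  let B := FreeAbelianGroup.of (ComodClass.mk (FDComod.ofGroupLike hb))
  have h : A * B - B * A ∈ grothendieckIdeal k H :=
    Ideal.Quotient.eq.1 (hcomm (Ideal.Quotient.mk _ A) (Ideal.Quotient.mk _ B))
  have h' := characterHom_eq_zero φ h
  rw [map_sub, sub_eq_zero] at h'
  simpa only [A, B, FreeAbelianGroup.of_mul_of, ComodClass.mk_mul_mk, characterHom_of_mk,
    FDComod.character_tensor_ofGroupLike] using h'

end GrothendieckRing

/-! ### Group-likes over a group of order two -/

section ZModTwo

variable {F : Type w} [Group F] (M : MatchedPair (Multiplicative (ZMod 2)) F)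

theorem multiplicative_zmod_two_cases (x : Multiplicative (ZMod 2)) :
    x = 1 ∨ x = Multiplicative.ofAdd 1 := by
  revert x
  decide

/-- The right action of a matched pair on a group with two elements is trivial. -/
theorem MatchedPair.ract_eq_self (x : Multiplicative (ZMod 2)) (f : F) : M.ract x f = x := by
  -- Acting by `f⁻¹` undoes `f` and fixes `1`, so only `1` can be sent to `1`.
  have h1 : ∀ y : Multiplicative (ZMod 2), M.ract y f = 1 → y = 1 := fun y h => by
    rw [← M.ract_ract_inv y f, h, M.one_ract]
  rcases multiplicative_zmod_two_cases x with rfl | rfl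
  · exact M.one_ract f
  · exact (multiplicative_zmod_two_cases _).resolve_left fun h => absurd (h1 _ h) (by decide)

variable {k : Type u} [Field k] {M} (D : CocyclePair k M)

/-- As `g ▷ f = f`, the diagonal terms of the coproduct come from `p_1 # f`, with coefficients `1`
and `τ(g, g; f)`, and the mixed terms from `p_g # f`, with coefficient `1`. In the tensor square the
coefficients are `1`, `c²` and `c`, so the condition is exactly `c² = τ(g, g; f)`. -/
theorem AbelianExt.isGroupLikeElem {f : F} (hf : M.lact (Multiplicative.ofAdd 1) f = f) {c : k}
    (hc : c * c = D.τ (Multiplicative.ofAdd 1) (Multiplicative.ofAdd 1) f) :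
    IsGroupLikeElem k (basis D (1, f) + c • basis D (Multiplicative.ofAdd 1, f)) where
  counit_eq_one := by
    have h : (Multiplicative.ofAdd 1 : Multiplicative (ZMod 2)) ≠ 1 := by decide
    simp [counit_basis, h]
  comul_eq_tmul_self := by
    have huniv : (Finset.univ : Finset (Multiplicative (ZMod 2))) =
        {1, Multiplicative.ofAdd 1} := by decide
    have hne : (1 : Multiplicative (ZMod 2)) ≠ Multiplicative.ofAdd 1 := by decide
    have hinv : (Multiplicative.ofAdd 1 : Multiplicative (ZMod 2))⁻¹ = Multiplicative.ofAdd 1 := by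
      decide
    have hsq : (Multiplicative.ofAdd 1 : Multiplicative (ZMod 2)) * Multiplicative.ofAdd 1 = 1 := by
      decide
    simp only [map_add, map_smul, comul_basis, huniv, Finset.sum_pair hne, inv_one, mul_one,
      one_mul, hinv, hsq, hf, M.one_lact, D.τ_one_left, D.τ_one_right, Units.val_one, one_smul,
      TensorProduct.add_tmul, TensorProduct.tmul_add, TensorProduct.tmul_smul,
      ← TensorProduct.smul_tmul', smul_add, smul_smul, hc]
    abel

/-- With a trivial right action, different `p_x` are orthogonal, and `σ(1; f, f') = 1`. The `p_1`
part therefore multiplies as in the group algebra of `F`, free of `c` and `c'`. -/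
theorem AbelianExt.repr_mul_apply_one (f f' : F) (c c' : k) (h : F) :
    (basis D).repr ((basis D (1, f) + c • basis D (Multiplicative.ofAdd 1, f)) *
      (basis D (1, f') + c' • basis D (Multiplicative.ofAdd 1, f'))) (1, h) =
      Finsupp.single (f * f') 1 h := by
  have hne : (Multiplicative.ofAdd 1 : Multiplicative (ZMod 2)) ≠ 1 := by decide
  classical
  simp [add_mul, mul_add, mul_basis, M.ract_eq_self, hne, hne.symm, D.σ_one,
    Finsupp.single_apply]

end ZModTwo

/-! ### The fixed points form an abelian group -/

theorem mainTheorem6 {k : Type*} [Field k] [IsAlgClosed k] [CharZero k] {F : Type*} [Group F]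
    (M : MatchedPair (Multiplicative (ZMod 2)) F) (D : CocyclePair k M)
    (hcomm : ∀ x y : GrothendieckRing k (AbelianExt D), x * y = y * x) :
    ∃ S : Subgroup F, (S : Set F) = {f : F | M.lact (Multiplicative.ofAdd 1) f = f} ∧
      ∀ a ∈ S, ∀ b ∈ S, a * b = b * a := by
  refine ⟨{ carrier := {f : F | M.lact (Multiplicative.ofAdd 1) f = f}
            mul_mem' := fun {a b} ha hb => ?_
            one_mem' := M.lact_one _
            inv_mem' := fun {a} ha => ?_ }, rfl, ?_⟩
  · rw [Set.mem_ofPred_eq] at ha hb ⊢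
    rw [M.lact_mul, M.ract_eq_self, ha, hb]
  · rw [Set.mem_ofPred_eq] at ha ⊢
    have h := M.lact_inv (Multiplicative.ofAdd 1) a
    rwa [M.ract_eq_self, ha, eq_comm] at h
  · intro a ha b hb
    -- Algebraic closedness supplies the square roots that make the two elements group-like.
    obtain ⟨c, hc⟩ := IsAlgClosed.exists_eq_mul_self
      (D.τ (Multiplicative.ofAdd 1) (Multiplicative.ofAdd 1) a : k)
    obtain ⟨d, hd⟩ := IsAlgClosed.exists_eq_mul_self
      (D.τ (Multiplicative.ofAdd 1) (Multiplicative.ofAdd 1) b : k)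
    have h := IsGroupLikeElem.mul_comm_of_grothendieckRing hcomm
      (AbelianExt.isGroupLikeElem D ha hc.symm) (AbelianExt.isGroupLikeElem D hb hd.symm)
    -- At `p_1 # ba` the product in the order `b`, `a` has coefficient `1`, while the other order
    -- has coefficient `0` unless `ab = ba`.
    have h' := congrArg (fun x => (AbelianExt.basis D).repr x (1, b * a)) h
    rw [AbelianExt.repr_mul_apply_one, AbelianExt.repr_mul_apply_one, Finsupp.single_eq_same] at h'
    by_contra hne
    rw [Finsupp.single_eq_of_ne' hne] at h'
    exact zero_ne_one h'
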